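/- Let $p$ be a prime and let $(R,\mathfrak m)$ be a commutative Noetherian local ring of characteristic $p$. For $e\ge 0$ let $F^e_*(R)$ denote $R$ viewed as an $R$-module via $r\cdot F^e_*(f)=F^e_*(r^{p^e}f)$. Recall that $R$ is F-finite if $F_*(R)$ is a finitely generated $R$-module; F-pure if $M\to M\otimes_R F_*(R)$, $m\mapsto m\otimes 1$, is injective for every $R$-module $M$; and that an F-finite domain $A$ of characteristic $p$ is strongly F-regular if for every $0\ne c\in A$ there are $e>0$ and an $A$-linear map $\varphi\colon F^e_*(A)\to A$ with $\varphi(F^e_*(c))=1$. Set $$\operatorname{fpt}(\mathfrak m)=\sup\{\lambda\in\mathbb R_{\ge 0} \mid \text{for all } e\gg 0 \text{ there is } f\in\mathfrak m^{\lfloor\lambda(p^e-1)\rfloor} \text{ such that the } R\text{-linear map } R\to F^e_*(R),\ 1\mapsto F^e_*(f), \text{ splits}\}$$ and $\operatorname{dfpt}(R)=\dim(R)-\operatorname{fpt}(\mathfrak m)$. Assume that $R$ is F-finite and F-pure. If there is a positive integer $k$ such that $\operatorname{dfpt}(R)<k+1$ and $R_{\mathfrak p}$ is strongly F-regular for every prime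 ideal $\mathfrak p$ of $R$ with $\dim(R_{\mathfrak p})\le k$, then $R$ is strongly F-regular. In particular, if $\operatorname{dfpt}(R)<2$ and $R$ is normal (that is, an integrally closed domain), then $R$ is strongly F-regular. -/

import Mathlib

open scoped TensorProduct NNReal ENNReal

universe u

/-- The ring `F^e_* R`: the ring `R` itself, regarded as an `R`-algebra (and hence as an
`R`-module) by restriction of scalars along the `e`-th iterate `r ↦ r ^ p ^ e` of Frobenius. -/
def FrobeniusPushforward (R : Type u) (_p _e : ℕ) : Type u := R

namespace FrobeniusPushforward

instance instCommRing (R : Type u) [CommRing R] (p e : ℕ) :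
    CommRing (FrobeniusPushforward R p e) := inferInstanceAs (CommRing R)

/-- The element `F^e_* f` of `F^e_* R` given by `f : R`; a ring isomorphism. -/
def of (R : Type u) [CommRing R] (p e : ℕ) : R ≃+* FrobeniusPushforward R p e :=
  RingEquiv.refl R

noncomputable instance instAlgebra (R : Type u) [CommRing R] (p e : ℕ) [Fact p.Prime]
    [CharP R p] : Algebra R (FrobeniusPushforward R p e) :=
  ((of R p e).toRingHom.comp (iterateFrobenius R p e)).toAlgebra

/-- The defining rule `r • F^e_* f = F^e_* (r ^ p ^ e * f)`. -/
theorem smul_of {R : Type u} [CommRing R] (p e : ℕ) [Fact p.Prime] [CharP R p] (r f : R) :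
    r • of R p e f = of R p e (r ^ p ^ e * f) := by
  rw [Algebra.smul_def, map_mul]
  rfl

end FrobeniusPushforward

/-- The localization of a ring of prime characteristic `p` at a prime ideal again has
characteristic `p`. -/
instance charP_localization_atPrime {R : Type u} [CommRing R] (p : ℕ) [hp : Fact p.Prime]
    [CharP R p] (P : Ideal R) [P.IsPrime] : CharP (Localization.AtPrime P) p := by
  refine (CharP.charP_iff_prime_eq_zero hp.out).mpr ?_
  rw [← map_natCast (algebraMap R (Localization.AtPrime P)) p, CharP.cast_eq_zero, map_zero]

section Definitions

variable (p : ℕ) [Fact p.Prime] (R : Type u) [CommRing R] [CharP R p]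

/-- `R` is F-finite: the Frobenius map is finite, that is, `F_* R` is a finite `R`-module. -/
def IsFFinite : Prop := Module.Finite R (FrobeniusPushforward R p 1)

/-- `R` is F-pure: the Frobenius map is a pure ring map, that is, the map
`M = M ⊗ R → M ⊗ F_* R` is injective for every `R`-module `M`. -/
def IsFPure : Prop :=
  ∀ (M : Type u) [AddCommGroup M] [Module R M],
    Function.Injective (fun m : M => m ⊗ₜ[R] (1 : FrobeniusPushforward R p 1))

/-- The `R`-linear map `R → F^e_* R` sending `1` to `F^e_* f` splits. -/
def FrobeniusSplitsAlong (e : ℕ) (f : R) : Prop :=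
  ∃ φ : FrobeniusPushforward R p e →ₗ[R] R,
    φ ∘ₗ LinearMap.toSpanSingleton R (FrobeniusPushforward R p e)
      (FrobeniusPushforward.of R p e f) = LinearMap.id

/-- `R` is strongly F-regular: it is an F-finite domain, and for every `c ≠ 0` there are `e > 0`
and an `R`-linear map `φ : F^e_* R → R` with `φ (F^e_* c) = 1`. -/
def IsStronglyFRegular : Prop :=
  IsFFinite p R ∧ IsDomain R ∧
    ∀ c : R, c ≠ 0 → ∃ e : ℕ, 0 < e ∧
      ∃ φ : FrobeniusPushforward R p e →ₗ[R] R, φ (FrobeniusPushforward.of R p e c) = 1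

/-- The pair `(R, I ^ lam)` is F-pure: for all sufficiently large `e` there is
`f ∈ I ^ ⌊lam * (p ^ e - 1)⌋` such that the map `R → F^e_* R`, `1 ↦ F^e_* f`, splits. -/
def IsFPurePair (I : Ideal R) (lam : ℝ≥0) : Prop :=
  ∀ᶠ e : ℕ in Filter.atTop,
    ∃ f ∈ I ^ ⌊(lam : ℝ) * ((p : ℝ) ^ e - 1)⌋₊, FrobeniusSplitsAlong p R e f

/-- The F-pure threshold of an ideal `I`: the supremum of all real `lam ≥ 0` such that
`(R, I ^ lam)` is F-pure. It is taken in the extended reals (so it is `-∞` if there is no such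
`lam`). -/
noncomputable def fpt (I : Ideal R) : EReal :=
  sSup {x : EReal | ∃ lam : ℝ≥0, IsFPurePair p R I lam ∧ x = ((lam : ℝ) : EReal)}

/-- The Krull dimension of `R` as an extended real number (for `R` nontrivial, so that the
dimension is not `-∞`). -/
noncomputable def krullDimEReal : EReal := (((ringKrullDim R).unbotD 0 : ℕ∞) : ℝ≥0∞)

/-- The defect of the F-pure threshold of a local ring `(R, 𝔪)`: `dim R - fpt 𝔪`. -/
noncomputable def dfpt [IsLocalRing R] : EReal :=
  krullDimEReal R - fpt p R (IsLocalRing.maximalIdeal R)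

end Definitions

/-!
Let `P` be the set of all `c` such that no map `φ : F^e_* R → R` with `e > 0` sends `F^e_* c` to a
unit. Then `P` is an ideal stable under all such maps, and it is prime as soon as it is proper,
because splittings along `a` and along `b` compose to a splitting along `a ^ p ^ e' * b`. For an
F-finite domain `R`, strong F-regularity says exactly that `P = 0` (`notMem_splittingPrime_iff`).

*The threshold is at most `dim (R / P)`.* If `φ (F^e_* f) = 1`, then `f ∉ P + 𝔪^[q]`, `q = p ^ e`,
since `φ` sends both `F^e_* P` and `F^e_* 𝔪^[q]` into `𝔪`. On the other hand, in a Noetherian local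
ring of dimension `d` there is `r` with `𝔪 ^ (d q + r) ⊆ 𝔪^[q]` for all `q`
(`IsLocalRing.exists_maximalIdeal_pow_le_of_pow_mem`). Over an infinite residue field this follows
from a reduction of `𝔪` with `d` generators; the following argument needs no assumption on the
residue field. Call a monomial in a system of generators `x` of `𝔪` standard if it is not in the
ideal generated by the monomials that are later in the degree-lexicographic order. The standard
monomials are closed under divisors, and those of degree `< n` number at most
`length (A / 𝔪 ^ n) + 1 = O(n ^ d)`. Hence, for some `c`, a standard monomial has at most `d`
exponents `≥ c`: otherwise its divisors would contain a box of dimension `d + 1`. So a standard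
monomial of degree `≥ d q + r` is divisible by some `x i ^ q`, and in large degrees every monomial
can be rewritten through standard ones.

*Conclusion.* As `ht P + dim (R / P) ≤ dim R`, the hypothesis `dfpt R < k + 1` gives `ht P ≤ k`, so
`R_P` is strongly F-regular. Maps `F^e_* R_P → R_P` come from maps `F^e_* R → R` up to
denominators, and `P` is stable under the latter, so `P R_P = 0`. If `c ∈ P` and `s c = 0` with
`s ∉ P`, a map sending `F^e_* s` to `1` shows that `c = 0`. Hence `P = 0`, and `R` is a strongly
F-regular domain. That `P` is proper already follows from `dfpt R < ⊤`, since then some pair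
`(R, 𝔪 ^ lam)` is F-pure.

If `R` is normal and `dim R_P ≤ 1`, then `R_P` is a local principal ideal domain, `F^e_* R_P` is
free over it, and for large `e` a given nonzero element has a unit coordinate in a basis.
-/

/-! ### Lengths of quotients by powers of the maximal ideal -/

section Length

variable {A : Type u} [CommRing A]

theorem Module.length_le_add_of_surjective {M N Q : Type*} [AddCommGroup M] [Module A M]
    [AddCommGroup N] [Module A N] [AddCommGroup Q] [Module A Q] (f : N →ₗ[A] M)
    (g : Q →ₗ[A] M ⧸ LinearMap.range f) (hg : Function.Surjective g) :
    Module.length A M ≤ Module.length A N + Module.length A Q := by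
  rw [Module.length_eq_add_of_exact (LinearMap.range f).subtype (LinearMap.range f).mkQ
    (Submodule.injective_subtype _) (Submodule.mkQ_surjective _)
    (LinearMap.exact_subtype_mkQ _)]
  exact add_le_add (Module.length_le_of_surjective f.rangeRestrict f.surjective_rangeRestrict)
    (Module.length_le_of_surjective g hg)

/-- Multiplication by `x` maps `A / (I, y)` onto the kernel of `A / (I, x y) → A / (I, x)`. -/
theorem Ideal.length_quotient_sup_span_mul_le (I : Ideal A) (x y : A) :
    Module.length A (A ⧸ I ⊔ Ideal.span {x * y}) ≤
      Module.length A (A ⧸ I ⊔ Ideal.span {y}) + Module.length A (A ⧸ I ⊔ Ideal.span {x}) := by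
  have hf : I ⊔ Ideal.span {y} ≤
      Submodule.comap (LinearMap.mulLeft A x) (I ⊔ Ideal.span {x * y}) := by
    refine sup_le (fun z hz => ?_) ?_
    · exact Ideal.mem_sup_left (I.mul_mem_left x hz)
    · rw [Ideal.span_le, Set.singleton_subset_iff]
      exact Ideal.mem_sup_right (Ideal.subset_span rfl)
  let f : (A ⧸ I ⊔ Ideal.span {y}) →ₗ[A] (A ⧸ I ⊔ Ideal.span {x * y}) :=
    Submodule.mapQ _ _ (LinearMap.mulLeft A x) hf
  have hg : I ⊔ Ideal.span {x} ≤ LinearMap.ker ((LinearMap.range f).mkQ ∘ₗ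
      Submodule.mkQ (I ⊔ Ideal.span {x * y})) := by
    refine sup_le (fun z hz => ?_) ?_
    · have : Submodule.mkQ (I ⊔ Ideal.span {x * y}) z = 0 := by
        rw [← LinearMap.mem_ker, Submodule.ker_mkQ]
        exact Ideal.mem_sup_left hz
      rw [LinearMap.mem_ker, LinearMap.comp_apply, this, map_zero]
    · rw [Ideal.span_le, Set.singleton_subset_iff, SetLike.mem_coe, LinearMap.mem_ker,
        LinearMap.comp_apply, ← LinearMap.mem_ker, Submodule.ker_mkQ]
      refine ⟨Submodule.mkQ _ 1, ?_⟩
      change Submodule.mkQ _ (x * 1) = _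
      rw [mul_one]
  refine Module.length_le_add_of_surjective f (Submodule.liftQ _ _ hg) ?_
  rw [← LinearMap.range_eq_top, Submodule.range_liftQ, LinearMap.range_eq_top]
  exact (Submodule.mkQ_surjective _).comp (Submodule.mkQ_surjective _)

theorem Ideal.length_quotient_sup_span_pow_le (I : Ideal A) (x : A) (n : ℕ) :
    Module.length A (A ⧸ I ⊔ Ideal.span {x ^ n}) ≤
      n * Module.length A (A ⧸ I ⊔ Ideal.span {x}) := by
  induction n with
  | zero =>
    have : Subsingleton (A ⧸ I ⊔ Ideal.span {x ^ 0}) := by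
      rw [Ideal.Quotient.subsingleton_iff]; simp
    simp
  | succ n ih =>
    rw [pow_succ]
    refine (Ideal.length_quotient_sup_span_mul_le I (x ^ n) x).trans ?_
    rw [Nat.cast_succ, add_mul, one_mul, add_comm]
    exact add_le_add_left ih _

theorem Ideal.length_quotient_sup_span_image_pow_le [DecidableEq A] (s : Finset A) (n : ℕ)
    (I : Ideal A) :
    Module.length A (A ⧸ I ⊔ Ideal.span ((fun y => y ^ n) '' (s : Set A))) ≤
      (n ^ s.card : ℕ) * Module.length A (A ⧸ I ⊔ Ideal.span (s : Set A)) := by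
  induction s using Finset.induction_on generalizing I with
  | empty => rw [Finset.coe_empty, Set.image_empty]; simp
  | insert a s ha ih =>
    have h1 := ih (I ⊔ Ideal.span {a ^ n})
    have h2 := Ideal.length_quotient_sup_span_pow_le (I ⊔ Ideal.span (s : Set A)) a n
    rw [Finset.coe_insert, Set.image_insert_eq, Ideal.span_insert, Ideal.span_insert,
      ← sup_assoc, ← sup_assoc, Finset.card_insert_of_notMem ha, pow_succ, Nat.cast_mul, mul_assoc]
    refine h1.trans ?_
    rw [sup_right_comm, sup_right_comm I (Ideal.span {a})]
    exact mul_le_mul_right h2 _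

/-- The easy half of the theory of the Hilbert–Samuel function: over a Noetherian local ring of
dimension `d`, the length of `A / 𝔪 ^ n` grows at most like `n ^ d`. The `n`-th powers of a
system of parameters lie in `𝔪 ^ n`. -/
theorem IsLocalRing.exists_length_quotient_maximalIdeal_pow_le [IsNoetherianRing A]
    [IsLocalRing A] {d : ℕ} (hd : ringKrullDim A = d) :
    ∃ L : ℕ, ∀ n : ℕ,
      Module.length A (A ⧸ IsLocalRing.maximalIdeal A ^ n) ≤ (L * n ^ d : ℕ) := by
  classical
  obtain ⟨s, hs, hcard⟩ :=
    Ideal.exists_finset_card_eq_height_of_isNoetherianRing (IsLocalRing.maximalIdeal A)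
  have hsd : s.card = d := by
    have h := IsLocalRing.maximalIdeal_height_eq_ringKrullDim (R := A)
    rw [hd, ← hcard] at h
    exact_mod_cast h
  have : IsArtinianRing (A ⧸ Ideal.span (s : Set A)) :=
    IsLocalRing.quotient_artinian_of_mem_minimalPrimes_of_isLocalRing _ hs
  have hfin : Module.length A (A ⧸ Ideal.span (s : Set A)) ≠ ⊤ := by
    rw [Module.length_eq_of_surjective (R := A ⧸ Ideal.span (s : Set A))
      (Ideal.Quotient.mk_surjective)]
    exact Module.length_ne_top
  refine ⟨(Module.length A (A ⧸ Ideal.span (s : Set A))).toNat, fun n => ?_⟩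
  have h := Ideal.length_quotient_sup_span_image_pow_le s n (⊥ : Ideal A)
  rw [bot_sup_eq, bot_sup_eq, hsd] at h
  have hle : Ideal.span ((fun y => y ^ n) '' (s : Set A)) ≤ IsLocalRing.maximalIdeal A ^ n := by
    rw [Ideal.span_le]
    rintro _ ⟨y, hy, rfl⟩
    exact Ideal.pow_mem_pow (hs.1.2 (Ideal.subset_span hy)) n
  refine (Module.length_le_of_surjective (Submodule.factor hle)
    (Submodule.factor_surjective hle)).trans (h.trans ?_)
  rw [Nat.cast_mul, mul_comm, ENat.natCast_toNat hfin]

end Length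

/-! ### Standard monomials -/

section Monomials

open Finset

variable {A : Type u} [CommRing A] {σ : Type*} [Fintype σ] {x : σ → A}

theorem span_range_pow_le_span_monomials (n : ℕ) :
    Ideal.span (Set.range x) ^ n ≤
      Ideal.span ((fun β : σ →₀ ℕ => ∏ i, x i ^ β i) '' {β | β.degree = n}) := by
  induction n with
  | zero =>
    rw [pow_zero, Ideal.one_eq_top, top_le_iff, Ideal.eq_top_iff_one]
    exact Ideal.subset_span ⟨0, by simp, by simp⟩
  | succ n ih =>
    rw [pow_succ]
    refine (Ideal.mul_mono_left ih).trans ?_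
    rw [Ideal.span_mul_span', Ideal.span_le]
    rintro _ ⟨_, ⟨β, hβ, rfl⟩, _, ⟨i, rfl⟩, rfl⟩
    refine Ideal.subset_span ⟨β + Finsupp.single i 1, ?_, ?_⟩
    · simp only [Set.mem_ofPred_eq] at hβ
      simp [hβ]
    · simp only [Finsupp.add_apply, pow_add, Finset.prod_mul_distrib]
      congr 1
      rw [Finset.prod_eq_single i] <;> simp +contextual [eq_comm]

/-- Coordinates `≥ c` contribute at most `q` each, the others less than `c` each. -/
theorem degree_le_of_card_filter_le {c d q : ℕ} {α : σ →₀ ℕ} (h : #{i | c ≤ α i} ≤ d)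
    (hq : ∀ i, α i ≤ q) : α.degree ≤ d * q + Fintype.card σ * c := by
  classical
  rw [Finsupp.degree_eq_sum, ← Finset.sum_filter_add_sum_filter_not Finset.univ (c ≤ α ·)]
  refine add_le_add ?_ ?_
  · refine (Finset.sum_le_card_nsmul _ _ q fun i _ => hq i).trans ?_
    exact Nat.mul_le_mul_right _ h
  · refine (Finset.sum_le_card_nsmul _ _ c fun i hi => ?_).trans ?_
    · exact (not_le.mp (Finset.mem_filter.mp hi).2).le
    · exact Nat.mul_le_mul_right _ (Finset.card_le_univ _)

variable [LinearOrder σ] (x)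

/-- The ideal generated by the monomials in `x` that come after the monomial of exponent `α` in
the degree-lexicographic order. -/
def laterMonomialsIdeal (α : σ →₀ ℕ) : Ideal A :=
  Ideal.span ((fun β : σ →₀ ℕ => ∏ i, x i ^ β i) '' {β | toDegLex α < toDegLex β})

/-- The exponent `α` is standard for the family `x` if its monomial does not lie in the ideal of
later monomials. For generators of the maximal ideal of a local ring this is the local analogue
of a standard monomial of a Gröbner basis. -/
def IsStandardExponent (α : σ →₀ ℕ) : Prop :=
  ∏ i, x i ^ α i ∉ laterMonomialsIdeal x α

variable {x}

/-- Divisors of standard monomials are standard, because the degree-lexicographic order is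
compatible with multiplication. -/
theorem IsStandardExponent.mono {α β : σ →₀ ℕ} (hβ : IsStandardExponent x β) (h : α ≤ β) :
    IsStandardExponent x α := by
  obtain ⟨γ, rfl⟩ := exists_add_of_le h
  intro hα
  refine hβ ?_
  simp only [Finsupp.add_apply, pow_add, Finset.prod_mul_distrib]
  have : ∀ z ∈ laterMonomialsIdeal x α,
      z * ∏ i, x i ^ γ i ∈ laterMonomialsIdeal x (α + γ) := by
    intro z hz
    refine Submodule.span_induction ?_ ?_ ?_ ?_ hz
    · rintro _ ⟨δ, hδ, rfl⟩
      refine Ideal.subset_span ⟨δ + γ, ?_, ?_⟩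
      · simp only [Set.mem_ofPred_eq, toDegLex_add] at hδ ⊢
        exact add_lt_add_left hδ _
      · simp only [Finsupp.add_apply, pow_add, Finset.prod_mul_distrib]
    · simp
    · intro a b _ _ ha hb
      rw [add_mul]
      exact Ideal.add_mem _ ha hb
    · intro a b _ hb
      rw [smul_eq_mul, mul_assoc]
      exact Ideal.mul_mem_left _ _ hb
  exact this _ hα

theorem laterMonomialsIdeal_le_of_lt {α β : σ →₀ ℕ} (h : toDegLex α < toDegLex β) :
    laterMonomialsIdeal x β ≤ laterMonomialsIdeal x α :=
  Ideal.span_mono (Set.image_mono fun _ hγ => h.trans hγ)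

theorem span_range_pow_le_laterMonomialsIdeal {α : σ →₀ ℕ} {n : ℕ} (h : α.degree < n) :
    Ideal.span (Set.range x) ^ n ≤ laterMonomialsIdeal x α := by
  refine (span_range_pow_le_span_monomials n).trans (Ideal.span_mono (Set.image_mono ?_))
  intro β hβ
  rw [Set.mem_ofPred_eq] at hβ ⊢
  rw [Finsupp.DegLex.lt_iff]
  left
  simpa [hβ] using h

/-- Standard exponents of degree below `n` give a strict chain of ideals above `𝔪 ^ n`. -/
theorem card_le_length_quotient_add_one (S : Finset (σ →₀ ℕ)) (n : ℕ)
    (hS : ∀ α ∈ S, IsStandardExponent x α) (hn : ∀ α ∈ S, α.degree < n) :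
    (S.card : ℕ∞) ≤ Module.length A (A ⧸ Ideal.span (Set.range x) ^ n) + 1 := by
  classical
  let T : Finset (DegLex (σ →₀ ℕ)) := S.map toDegLex.toEmbedding
  have hT : T.card = S.card := Finset.card_map _
  obtain h0 | ⟨k, hk⟩ : S.card = 0 ∨ ∃ k, S.card = k + 1 := by
    cases h : S.card <;> simp
  · simp [h0]
  let e := T.orderEmbOfFin (hT.trans hk)
  have he : ∀ i, ofDegLex (e i) ∈ S := fun i => by
    have := T.orderEmbOfFin_mem (hT.trans hk) i
    obtain ⟨a, ha, hae⟩ := Finset.mem_map.mp this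
    have : ofDegLex (e i) = a := by
      rw [show e i = toDegLex a from hae.symm]; rfl
    rwa [this]
  let F : Fin (k + 1) → Submodule A (A ⧸ Ideal.span (Set.range x) ^ n) := fun i =>
    Submodule.map (Submodule.mkQ (Ideal.span (Set.range x) ^ n))
      (laterMonomialsIdeal x (ofDegLex (e i.rev)))
  have hF : StrictMono F := by
    intro i j hij
    have hlt : e j.rev < e i.rev := e.strictMono (Fin.rev_lt_rev.mpr hij)
    refine lt_of_le_of_ne
      (Submodule.map_mono (laterMonomialsIdeal_le_of_lt (x := x) hlt)) fun heq => ?_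
    have hc := congrArg (Submodule.comap (Submodule.mkQ (Ideal.span (Set.range x) ^ n))) heq
    simp only [F, Submodule.comap_map_mkQ] at hc
    rw [sup_eq_right.mpr (span_range_pow_le_laterMonomialsIdeal (hn _ (he _))),
      sup_eq_right.mpr (span_range_pow_le_laterMonomialsIdeal (hn _ (he _)))] at hc
    refine hS _ (he i.rev) ?_
    rw [hc]
    exact Ideal.subset_span ⟨_, hlt, rfl⟩
  have hlen : ((k : ℕ∞) : WithBot ℕ∞) ≤
      (Module.length A (A ⧸ Ideal.span (Set.range x) ^ n) : WithBot ℕ∞) := by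
    rw [Module.coe_length]
    exact Order.LTSeries.length_le_krullDim (LTSeries.mk k F hF)
  rw [hk, Nat.cast_succ]
  exact add_le_add_left (WithBot.coe_le_coe.mp hlen) _

/-- If the length of `A / 𝔪 ^ n` is `O(n ^ d)`, then a standard exponent cannot have more than `d`
large coordinates: otherwise a `(d + 1)`-dimensional box below it would consist of standard
exponents, which are too many. -/
theorem exists_card_filter_le_of_isStandardExponent {L d : ℕ}
    (hL : ∀ n : ℕ, Module.length A (A ⧸ Ideal.span (Set.range x) ^ n) ≤ (L * n ^ d : ℕ)) :
    ∃ c : ℕ, ∀ α : σ →₀ ℕ, IsStandardExponent x α → #{i | c ≤ α i} ≤ d := by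
  classical
  -- a box of side `c + 1` would give `(c + 1) ^ (d + 1) ≤ L * ((d + 1) * (c + 1)) ^ d + 1`,
  -- which fails for this value of `c`
  refine ⟨L * (d + 1) ^ d + 1, fun α hα => ?_⟩
  set c := L * (d + 1) ^ d + 1 with hc
  by_contra! hcard
  obtain ⟨T, hTsub, hT⟩ := Finset.exists_subset_card_eq (Nat.succ_le_of_lt hcard)
  let β : σ →₀ ℕ := Finsupp.equivFunOnFinite.symm fun i => if i ∈ T then c else 0
  have hβ : ∀ i, β i = if i ∈ T then c else 0 := fun i => rfl
  have hβα : β ≤ α := by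
    intro i
    rw [hβ]
    split_ifs with hi
    · exact (Finset.mem_filter.mp (hTsub hi)).2
    · exact Nat.zero_le _
  have hdeg : β.degree = (d + 1) * c := by
    rw [Finsupp.degree_eq_sum]
    simp [hβ, hT]
  have hbox : (Finset.Iic β).card = (c + 1) ^ (d + 1) := by
    rw [Finsupp.card_Iic]
    have hsupp : β.support = T := by
      ext i; simp [hβ, hc]
    rw [hsupp, Finset.prod_congr rfl (g := fun _ => c + 1), Finset.prod_const, hT]
    intro i hi
    simp [hβ, hi]
  have h := card_le_length_quotient_add_one (x := x) (Finset.Iic β) ((d + 1) * (c + 1))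
    (fun γ hγ => hα.mono ((Finset.mem_Iic.mp hγ).trans hβα))
    (fun γ hγ => ((Finsupp.degree_mono (Finset.mem_Iic.mp hγ)).trans hdeg.le).trans_lt
      (Nat.mul_lt_mul_of_pos_left (Nat.lt_succ_self c) (Nat.succ_pos d)))
  have h2 : (c + 1) ^ (d + 1) ≤ L * ((d + 1) * (c + 1)) ^ d + 1 := by
    have := h.trans (add_le_add_left (hL _) 1)
    rw [hbox] at this
    exact_mod_cast this
  have h3 : 1 ≤ (c + 1) ^ d := Nat.one_le_pow _ _ (Nat.succ_pos _)
  have h4 : L * ((d + 1) * (c + 1)) ^ d = (c - 1) * (c + 1) ^ d := by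
    rw [mul_pow, hc, Nat.add_sub_cancel, mul_assoc]
  rw [h4, hc, Nat.add_sub_cancel] at h2
  rw [hc] at h3
  rw [pow_succ] at h2
  nlinarith

/-- Reduction to standard monomials: in degrees `≥ N`, the span of the monomials is contained in an
ideal `K` as soon as `K` contains the standard ones and all monomials of large degree. -/
theorem span_range_pow_le_of_isStandardExponent {K : Ideal A} {M N : ℕ}
    (hM : Ideal.span (Set.range x) ^ M ≤ K)
    (hK : ∀ α : σ →₀ ℕ, IsStandardExponent x α → N ≤ α.degree → ∏ i, x i ^ α i ∈ K) :
    Ideal.span (Set.range x) ^ N ≤ K := by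
  classical
  suffices H : ∀ α : σ →₀ ℕ, N ≤ α.degree → ∏ i, x i ^ α i ∈ K by
    refine (span_range_pow_le_span_monomials N).trans (Ideal.span_le.mpr ?_)
    rintro _ ⟨β, hβ, rfl⟩
    exact H β (le_of_eq (Eq.symm hβ))
  by_contra! hbad
  have hlarge : ∀ α : σ →₀ ℕ, M ≤ α.degree → ∏ i, x i ^ α i ∈ K := fun α hα => by
    refine hM (Ideal.pow_le_pow_right hα ?_)
    rw [Finsupp.degree_eq_sum, ← Finset.prod_pow_eq_pow_sum]
    refine Ideal.prod_mem_prod fun i _ => Ideal.pow_mem_pow ?_ _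
    exact Ideal.subset_span (Set.mem_range_self i)
  let B : Set (DegLex (σ →₀ ℕ)) :=
    toDegLex '' {α : σ →₀ ℕ | N ≤ α.degree ∧ ∏ i, x i ^ α i ∉ K}
  have hBfin : B.Finite := by
    refine Set.Finite.image _ ((Finsupp.finite_of_degree_le M).subset fun α hα => ?_)
    by_contra hlt
    exact hα.2 (hlarge α (not_le.mp hlt).le)
  have hBne : B.Nonempty := hbad.imp fun α hα => ⟨α, hα, rfl⟩
  obtain ⟨_, ⟨α, ⟨hαN, hαK⟩, rfl⟩, hmax⟩ := Set.exists_max_image B id hBfin hBne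
  refine hαK ?_
  by_cases hα : IsStandardExponent x α
  · exact hK α hα hαN
  · -- the later monomials lie in `K`, as `α` is the last bad exponent
    rw [IsStandardExponent, not_not] at hα
    refine (Ideal.span_le.mpr ?_ : laterMonomialsIdeal x α ≤ K) hα
    rintro _ ⟨β, hβ, rfl⟩
    by_contra hβK
    have hdeg : α.degree ≤ β.degree := Finsupp.DegLex.monotone_degree (le_of_lt hβ)
    exact (hmax (toDegLex β) ⟨β, ⟨hαN.trans hdeg, hβK⟩, rfl⟩).not_gt hβ

end Monomials

/-! ### Powers of the maximal ideal and ideals of `q`-th powers -/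

/-- Over a Noetherian local ring of dimension `d`, the power `𝔪 ^ (d q + r)` is contained in the
ideal generated by all `q`-th powers of elements of `𝔪`, with `r` independent of `q`. -/
theorem IsLocalRing.exists_maximalIdeal_pow_le_of_pow_mem {A : Type u} [CommRing A]
    [IsNoetherianRing A] [IsLocalRing A] {d : ℕ} (hd : ringKrullDim A = d) :
    ∃ r : ℕ, ∀ (q : ℕ) (K : Ideal A), (∀ a ∈ IsLocalRing.maximalIdeal A, a ^ q ∈ K) →
      IsLocalRing.maximalIdeal A ^ (d * q + r) ≤ K := by
  obtain ⟨n, x, hx⟩ := Submodule.fg_iff_exists_fin_generating_family.mp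
    (IsNoetherian.noetherian (IsLocalRing.maximalIdeal A))
  change Ideal.span (Set.range x) = IsLocalRing.maximalIdeal A at hx
  obtain ⟨L, hL⟩ := IsLocalRing.exists_length_quotient_maximalIdeal_pow_le hd
  rw [← hx] at hL ⊢
  obtain ⟨c, hc⟩ := exists_card_filter_le_of_isStandardExponent hL
  refine ⟨Fintype.card (Fin n) * c + 1, fun q K hK => ?_⟩
  obtain ⟨M, hM⟩ := Ideal.exists_pow_le_of_le_radical_of_fg (fun a ha => ⟨q, hK a ha⟩)
    (IsNoetherian.noetherian (Ideal.span (Set.range x)))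
  refine span_range_pow_le_of_isStandardExponent hM fun α hα hdeg => ?_
  by_cases hq : ∀ i, α i ≤ q
  · exact absurd (degree_le_of_card_filter_le (hc α hα) hq) (by omega)
  · obtain ⟨i, hi⟩ := not_forall.mp hq
    refine Ideal.mem_of_dvd _ (Finset.dvd_prod_of_mem _ (Finset.mem_univ i)) ?_
    refine Ideal.mem_of_dvd _ (pow_dvd_pow _ (not_le.mp hi).le) ?_
    exact hK _ (Ideal.subset_span (Set.mem_range_self i))

/-! ### The splitting prime -/

section SplittingPrime

open FrobeniusPushforward

variable {p : ℕ} [Fact p.Prime] {R : Type u} [CommRing R] [CharP R p]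

theorem frobeniusSplitsAlong_iff {e : ℕ} {f : R} :
    FrobeniusSplitsAlong p R e f ↔
      ∃ φ : FrobeniusPushforward R p e →ₗ[R] R, φ (of R p e f) = 1 := by
  refine exists_congr fun φ => ⟨fun h => ?_, fun h => LinearMap.ext_ring ?_⟩
  · simpa using LinearMap.congr_fun h 1
  · simpa using h

namespace FrobeniusPushforward

/-- The map `F^e_* x ↦ φ (F^e_* (a * x))`. -/
noncomputable def premul {e : ℕ} (φ : FrobeniusPushforward R p e →ₗ[R] R) (a : R) :
    FrobeniusPushforward R p e →ₗ[R] R :=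
  φ ∘ₗ LinearMap.mulLeft R (of R p e a)

theorem premul_of {e : ℕ} (φ : FrobeniusPushforward R p e →ₗ[R] R) (a x : R) :
    premul φ a (of R p e x) = φ (of R p e (a * x)) := by
  simp [premul]

theorem map_of_pow_mul {e : ℕ} (φ : FrobeniusPushforward R p e →ₗ[R] R) (a x : R) :
    φ (of R p e (a ^ p ^ e * x)) = a * φ (of R p e x) := by
  rw [← smul_of, map_smul, smul_eq_mul]

/-- The composition `F^(e + e')_* R → F^e_* R → R` of `F^e_* ψ` and `φ`. -/
noncomputable def compose {e e' : ℕ} (φ : FrobeniusPushforward R p e →ₗ[R] R)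
    (ψ : FrobeniusPushforward R p e' →ₗ[R] R) : FrobeniusPushforward R p (e + e') →ₗ[R] R where
  toFun x := φ (of R p e (ψ (of R p e' ((of R p (e + e')).symm x))))
  map_add' x y := by simp
  map_smul' r x := by
    obtain ⟨x, rfl⟩ := (of R p (e + e')).surjective x
    rw [smul_of, RingEquiv.symm_apply_apply, RingEquiv.symm_apply_apply, pow_add, pow_mul,
      map_of_pow_mul, map_of_pow_mul]
    rfl

theorem compose_of {e e' : ℕ} (φ : FrobeniusPushforward R p e →ₗ[R] R)
    (ψ : FrobeniusPushforward R p e' →ₗ[R] R) (x : R) :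
    compose φ ψ (of R p (e + e') x) = φ (of R p e (ψ (of R p e' x))) := rfl

end FrobeniusPushforward

variable [IsLocalRing R]

variable (p R) in
/-- The splitting prime of a local ring: the elements `c` such that no `R`-linear map
`F^e_* R → R` with `e > 0` sends `F^e_* c` to a unit. -/
def splittingPrime : Ideal R where
  carrier := {c | ∀ e : ℕ, 0 < e → ∀ φ : FrobeniusPushforward R p e →ₗ[R] R,
    φ (of R p e c) ∈ IsLocalRing.maximalIdeal R}
  add_mem' ha hb e he φ := by
    rw [map_add, map_add]
    exact add_mem (ha e he φ) (hb e he φ)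
  zero_mem' e _ φ := by simp
  smul_mem' a x hx e he φ := by
    rw [smul_eq_mul, ← premul_of]
    exact hx e he _

theorem notMem_splittingPrime_iff {c : R} :
    c ∉ splittingPrime p R ↔
      ∃ e : ℕ, 0 < e ∧ ∃ φ : FrobeniusPushforward R p e →ₗ[R] R, φ (of R p e c) = 1 := by
  constructor
  · intro h
    change ¬ ∀ e : ℕ, 0 < e → ∀ φ : FrobeniusPushforward R p e →ₗ[R] R,
      φ (of R p e c) ∈ IsLocalRing.maximalIdeal R at h
    push Not at h
    obtain ⟨e, he, φ, hφ⟩ := h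
    obtain ⟨u, hu⟩ : IsUnit (φ (of R p e c)) := by
      simpa [IsLocalRing.mem_maximalIdeal, mem_nonunits_iff] using hφ
    refine ⟨e, he, (↑u⁻¹ : R) • φ, ?_⟩
    rw [LinearMap.smul_apply, ← hu, smul_eq_mul, Units.inv_mul]
  · rintro ⟨e, he, φ, hφ⟩ h
    have := h e he φ
    rw [hφ] at this
    exact (Ideal.ne_top_iff_one _).mp (IsLocalRing.maximalIdeal.isMaximal R).ne_top this

/-- The splitting prime is stable under all `R`-linear maps `F^e_* R → R`. -/
theorem map_of_mem_splittingPrime {c : R} (hc : c ∈ splittingPrime p R) {e : ℕ}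
    (φ : FrobeniusPushforward R p e →ₗ[R] R) : φ (of R p e c) ∈ splittingPrime p R := by
  intro e' he' ψ
  exact hc (e' + e) (by omega) (compose ψ φ)

theorem splittingPrime_isPrime (h : (1 : R) ∉ splittingPrime p R) :
    (splittingPrime p R).IsPrime := by
  refine Ideal.isPrime_iff.mpr ⟨(Ideal.ne_top_iff_one _).mpr h, fun {a b} hab => ?_⟩
  by_contra! hcon
  obtain ⟨e, he, φ, hφ⟩ := notMem_splittingPrime_iff.mp hcon.1
  obtain ⟨e', he', ψ, hψ⟩ := notMem_splittingPrime_iff.mp hcon.2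
  -- `ψ` turns `a ^ p ^ e' * b` into `a`, and `φ` turns `a` into `1`
  have hmem : a ^ p ^ e' * b ∈ splittingPrime p R := by
    obtain ⟨k, hk⟩ := Nat.exists_eq_succ_of_ne_zero (pow_ne_zero e' (Fact.out : p.Prime).ne_zero)
    rw [hk, pow_succ, mul_assoc]
    exact Ideal.mul_mem_left _ _ hab
  have := map_of_mem_splittingPrime hmem ψ
  rw [map_of_pow_mul, hψ, mul_one] at this
  exact hcon.1 this

end SplittingPrime

/-! ### The F-pure threshold is bounded by the dimension at the splitting prime -/

section Threshold

open FrobeniusPushforward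

variable {p : ℕ} [hp : Fact p.Prime] {R : Type u} [CommRing R] [CharP R p] [IsLocalRing R]

/-- If `F^e_* f` generates a free summand of `F^e_* R`, then `f` lies in no power of the maximal
ideal whose exponent exceeds `p ^ e * dim (R / P) + O(1)`, where `P` is the splitting prime:
otherwise `f` would lie in `P + 𝔪^[p ^ e]`, which every map `F^e_* R → R` sends into `𝔪`. -/
theorem exists_lt_of_mem_pow_of_splits [IsNoetherianRing R] {d : ℕ}
    (h1 : (1 : R) ∉ splittingPrime p R) (hd : ringKrullDim (R ⧸ splittingPrime p R) = d) :
    ∃ r : ℕ, ∀ (e n : ℕ) (f : R), 0 < e → f ∈ IsLocalRing.maximalIdeal R ^ n →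
      FrobeniusSplitsAlong p R e f → n < d * p ^ e + r := by
  set P := splittingPrime p R
  have hprime : P.IsPrime := splittingPrime_isPrime h1
  have : Nontrivial (R ⧸ P) := Ideal.Quotient.nontrivial_iff.mpr hprime.ne_top
  have : IsLocalRing (R ⧸ P) :=
    IsLocalRing.of_surjective' (Ideal.Quotient.mk P) Ideal.Quotient.mk_surjective
  have hmap : (IsLocalRing.maximalIdeal R).map (Ideal.Quotient.mk P) =
      IsLocalRing.maximalIdeal (R ⧸ P) :=
    IsLocalRing.map_maximalIdeal_of_surjective _ Ideal.Quotient.mk_surjective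
  obtain ⟨r, hr⟩ := IsLocalRing.exists_maximalIdeal_pow_le_of_pow_mem hd
  refine ⟨r, fun e n f he hf hs => ?_⟩
  by_contra! hn
  obtain ⟨φ, hφ⟩ := frobeniusSplitsAlong_iff.mp hs
  let J : Ideal R := Ideal.span ((fun a => a ^ p ^ e) '' (IsLocalRing.maximalIdeal R : Set R))
  have hK := hr (p ^ e) (J.map (Ideal.Quotient.mk P)) (fun a ha => by
    rw [← hmap, Ideal.mem_map_iff_of_surjective _ Ideal.Quotient.mk_surjective] at ha
    obtain ⟨a, ha, rfl⟩ := ha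
    rw [← map_pow]
    exact Ideal.mem_map_of_mem _ (Ideal.subset_span ⟨a, ha, rfl⟩))
  have hf' : Ideal.Quotient.mk P f ∈ J.map (Ideal.Quotient.mk P) := by
    refine hK (Ideal.pow_le_pow_right hn ?_)
    rw [← hmap, ← Ideal.map_pow]
    exact Ideal.mem_map_of_mem _ hf
  rw [Ideal.mem_quotient_iff_mem_sup, Submodule.mem_sup] at hf'
  obtain ⟨v, hv, u, hu, rfl⟩ := hf'
  have hJ : ∀ y : R, φ (of R p e (v * y)) ∈ IsLocalRing.maximalIdeal R := by
    refine Submodule.span_induction ?_ ?_ ?_ ?_ hv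
    · rintro _ ⟨a, ha, rfl⟩ y
      rw [map_of_pow_mul]
      exact Ideal.mul_mem_right _ _ ha
    · intro y
      rw [zero_mul, map_zero, map_zero]
      exact zero_mem _
    · intro a b _ _ ha hb y
      rw [add_mul, map_add, map_add]
      exact add_mem (ha y) (hb y)
    · intro a b _ hb y
      rw [smul_eq_mul, mul_comm a b, mul_assoc]
      exact hb _
  have h1m : (1 : R) ∈ IsLocalRing.maximalIdeal R := by
    rw [← hφ, map_add, map_add]
    exact add_mem (mul_one v ▸ hJ 1) (hu e he φ)
  exact (Ideal.ne_top_iff_one _).mp (IsLocalRing.maximalIdeal.isMaximal R).ne_top h1m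

theorem IsFPurePair.le_of_ringKrullDim_quotient_splittingPrime [IsNoetherianRing R] {d : ℕ}
    (h1 : (1 : R) ∉ splittingPrime p R) (hd : ringKrullDim (R ⧸ splittingPrime p R) = d)
    {lam : ℝ≥0} (h : IsFPurePair p R (IsLocalRing.maximalIdeal R) lam) : (lam : ℝ) ≤ d := by
  obtain ⟨r, hr⟩ := exists_lt_of_mem_pow_of_splits h1 hd
  by_contra! hlt
  have hp1 : (1 : ℝ) < p := by exact_mod_cast hp.out.one_lt
  have hlim : Filter.Tendsto (fun e : ℕ => ((lam : ℝ) - d) * (p : ℝ) ^ e) Filter.atTop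
      Filter.atTop :=
    (tendsto_pow_atTop_atTop_of_one_lt hp1).const_mul_atTop (sub_pos.mpr hlt)
  obtain ⟨e, ⟨⟨f, hf, hs⟩, he⟩, hlarge⟩ :=
    ((h.and (Filter.eventually_gt_atTop 0)).and
      (hlim.eventually_ge_atTop ((lam : ℝ) + r))).exists
  have hn : (⌊(lam : ℝ) * ((p : ℝ) ^ e - 1)⌋₊ : ℝ) + 1 ≤ d * (p : ℝ) ^ e + r := by
    exact_mod_cast hr e _ f he hf hs
  have hfl := Nat.lt_floor_add_one ((lam : ℝ) * ((p : ℝ) ^ e - 1))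
  linarith

theorem IsFPurePair.one_notMem_splittingPrime {I : Ideal R} {lam : ℝ≥0}
    (h : IsFPurePair p R I lam) : (1 : R) ∉ splittingPrime p R := by
  obtain ⟨e, ⟨f, -, hs⟩, he⟩ := (h.and (Filter.eventually_gt_atTop 0)).exists
  obtain ⟨φ, hφ⟩ := frobeniusSplitsAlong_iff.mp hs
  refine notMem_splittingPrime_iff.mpr ⟨e, he, premul φ f, ?_⟩
  rw [premul_of, mul_one, hφ]

theorem krullDimEReal_of_ringKrullDim_eq {S : Type u} [CommRing S] {n : ℕ}
    (h : ringKrullDim S = n) : krullDimEReal S = n := by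
  have : ((n : ℕ) : WithBot ℕ∞) = (((n : ℕ∞)) : WithBot ℕ∞) := rfl
  rw [krullDimEReal, h, this, WithBot.unbotD_coe, ENat.toENNReal_coe]
  rfl

theorem exists_ringKrullDim_eq_natCast (S : Type u) [CommRing S] [FiniteRingKrullDim S] :
    ∃ n : ℕ, ringKrullDim S = n := by
  obtain ⟨m, hm⟩ := WithBot.ne_bot_iff_exists.mp (ringKrullDim_ne_bot (R := S))
  obtain ⟨n, rfl⟩ := ENat.ne_top_iff_exists.mp fun h : m = ⊤ =>
    ringKrullDim_ne_top (R := S) (by rw [← hm, h]; rfl)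
  exact ⟨n, hm.symm⟩

theorem Ideal.height_add_ringKrullDim_quotient_le {S : Type u} [CommRing S] (P : Ideal S)
    [hP : P.IsPrime] : (P.height : WithBot ℕ∞) + ringKrullDim (S ⧸ P) ≤ ringKrullDim S := by
  have hne : Nonempty (PrimeSpectrum S) := ⟨⟨P, hP⟩⟩
  have hquot : ringKrullDim (S ⧸ P) =
      (Order.coheight (⟨P, hP⟩ : PrimeSpectrum S) : WithBot ℕ∞) := by
    rw [ringKrullDim_quotient, Order.coheight_eq_krullDim_Ici]
    rfl
  rw [hquot, PrimeSpectrum.height_eq_orderHeight ⟨P, hP⟩, ringKrullDim,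
    Order.krullDim_eq_iSup_height_add_coheight_of_nonempty, ← WithBot.coe_add]
  exact WithBot.coe_le_coe.mpr
    (le_iSup (fun a : PrimeSpectrum S => Order.height a + Order.coheight a) ⟨P, hP⟩)

/-- If the defect of the F-pure threshold is less than `k + 1`, then the splitting prime is a
prime ideal of height at most `k`, because the threshold is at most the dimension of the
quotient by the splitting prime. -/
theorem splittingPrime_height_le_of_dfpt_lt [IsNoetherianRing R] {k : ℕ}
    (h : dfpt p R < (k : EReal) + 1) :
    (1 : R) ∉ splittingPrime p R ∧ (splittingPrime p R).height ≤ k := by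
  obtain ⟨n, hn⟩ := exists_ringKrullDim_eq_natCast R
  rw [dfpt, krullDimEReal_of_ringKrullDim_eq hn] at h
  have h1 : (1 : R) ∉ splittingPrime p R := by
    intro hmem
    have hempty : {x : EReal | ∃ lam : ℝ≥0,
        IsFPurePair p R (IsLocalRing.maximalIdeal R) lam ∧ x = ((lam : ℝ) : EReal)} = ∅ :=
      Set.eq_empty_of_forall_notMem fun x ⟨lam, hlam, _⟩ => hlam.one_notMem_splittingPrime hmem
    -- the supremum of the empty set is `⊥`, so the defect would be `⊤`
    rw [fpt, hempty, sSup_empty] at h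
    rw [sub_eq_add_neg, EReal.neg_bot, EReal.add_top_of_ne_bot (EReal.natCast_ne_bot n)] at h
    exact not_top_lt h
  refine ⟨h1, ?_⟩
  have hprime := splittingPrime_isPrime h1
  have : Nontrivial (R ⧸ splittingPrime p R) := Ideal.Quotient.nontrivial_iff.mpr hprime.ne_top
  have : IsLocalRing (R ⧸ splittingPrime p R) :=
    IsLocalRing.of_surjective' (Ideal.Quotient.mk _) Ideal.Quotient.mk_surjective
  obtain ⟨d, hd⟩ := exists_ringKrullDim_eq_natCast (R ⧸ splittingPrime p R)
  have hfpt : fpt p R (IsLocalRing.maximalIdeal R) ≤ (d : EReal) := by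
    refine sSup_le ?_
    rintro _ ⟨lam, hlam, rfl⟩
    have := hlam.le_of_ringKrullDim_quotient_splittingPrime h1 hd
    exact_mod_cast this
  have hlt : (n : EReal) - d < (k : EReal) + 1 := (EReal.sub_le_sub le_rfl hfpt).trans_lt h
  have hlt' : (n : ℝ) - d < k + 1 := by
    rw [← EReal.coe_lt_coe_iff]
    push_cast
    exact hlt
  have hnat : n < k + 1 + d := by
    have : (n : ℝ) < k + 1 + d := by linarith
    exact_mod_cast this
  have hle := Ideal.height_add_ringKrullDim_quotient_le (splittingPrime p R)
  rw [hd, hn] at hle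
  have hle' : (splittingPrime p R).height + d ≤ n := by exact_mod_cast hle
  have : (splittingPrime p R).height + d ≤ (k : ℕ∞) + d :=
    hle'.trans (by exact_mod_cast (by omega : n ≤ k + d))
  exact (ENat.add_le_add_iff_right (ENat.natCast_ne_top d)).mp this

end Threshold

/-! ### F-finiteness and localization -/

section Localization

open FrobeniusPushforward

variable {p : ℕ} [hp : Fact p.Prime] {R : Type u} [CommRing R] [CharP R p]

theorem IsFFinite.finite (h : IsFFinite p R) (e : ℕ) :
    Module.Finite R (FrobeniusPushforward R p e) := by
  have h1 : (frobenius R p).Finite := by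
    have : (iterateFrobenius R p 1).Finite := h
    rwa [iterateFrobenius_one] at this
  suffices H : (iterateFrobenius R p e).Finite from H
  induction e with
  | zero => rw [iterateFrobenius_zero]; exact RingHom.Finite.id R
  | succ e ih =>
    have : iterateFrobenius R p (e + 1) = (iterateFrobenius R p e).comp (frobenius R p) := by
      ext x; simp [iterateFrobenius_def, frobenius_def, pow_succ', pow_mul]
    rw [this]
    exact ih.comp h1

theorem IsFFinite.localization_atPrime (h : IsFFinite p R) (P : Ideal R) [P.IsPrime] :
    IsFFinite p (Localization.AtPrime P) := by
  obtain ⟨s, hs⟩ := (h : Module.Finite R (FrobeniusPushforward R p 1)).fg_top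
  let F : R →+* FrobeniusPushforward (Localization.AtPrime P) p 1 :=
    (of _ p 1).toRingHom.comp (algebraMap R (Localization.AtPrime P))
  classical
  refine Module.finite_def.mpr ⟨s.image fun x => F ((of R p 1).symm x), ?_⟩
  rw [eq_top_iff]
  let N := Submodule.span (Localization.AtPrime P)
    (↑(s.image fun x => F ((of R p 1).symm x)) :
      Set (FrobeniusPushforward (Localization.AtPrime P) p 1))
  have hR : ∀ x : FrobeniusPushforward R p 1, F ((of R p 1).symm x) ∈ N := by
    intro x
    have hx : x ∈ Submodule.span R (s : Set (FrobeniusPushforward R p 1)) := hs ▸ trivial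
    refine Submodule.span_induction ?_ ?_ ?_ ?_ hx
    · intro y hy
      exact Submodule.subset_span (Finset.mem_coe.mpr (Finset.mem_image_of_mem _ hy))
    · rw [map_zero, map_zero]; exact zero_mem _
    · intro a b _ _ ha hb
      rw [map_add, map_add]; exact add_mem ha hb
    · intro r y _ hy
      obtain ⟨y, rfl⟩ := (of R p 1).surjective y
      rw [smul_of, RingEquiv.symm_apply_apply]
      have : F (r ^ p ^ 1 * y) = algebraMap R (Localization.AtPrime P) r • F y := by
        change of _ p 1 (algebraMap R _ (r ^ p ^ 1 * y)) = _ • of _ p 1 (algebraMap R _ y)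
        rw [smul_of, map_mul, map_pow]
      rw [this]
      exact N.smul_mem _ hy
  rintro x -
  obtain ⟨x, rfl⟩ := (of _ p 1).surjective x
  obtain ⟨⟨a, t⟩, rfl⟩ := IsLocalization.mk'_surjective P.primeCompl x
  obtain ⟨k, hk⟩ := Nat.exists_eq_succ_of_ne_zero hp.out.ne_zero
  -- `a / t = (1 / t) ^ p * (t ^ (p - 1) * a)`
  have key : of _ p 1 (IsLocalization.mk' (Localization.AtPrime P) a t) =
      (IsLocalization.mk' (Localization.AtPrime P) 1 t) • F ((t : R) ^ k * a) := by
    change _ = _ • of _ p 1 (algebraMap R _ ((t : R) ^ k * a))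
    rw [smul_of, pow_one, ← IsLocalization.mk'_pow, one_pow, mul_comm,
      ← IsLocalization.mk'_eq_mul_mk'_one]
    congr 1
    rw [IsLocalization.mk'_eq_iff_eq]
    congr 1
    rw [hk, Nat.succ_eq_add_one, SubmonoidClass.coe_pow]
    ring
  rw [key]
  exact N.smul_mem _ (hR (of R p 1 _))

/-- A linear map `F^e_* R_P → R_P` is, up to an element outside `P`, the localization of a linear
map `F^e_* R → R`. -/
theorem exists_linearMap_of_localization [IsNoetherianRing R] (h : IsFFinite p R) (P : Ideal R)
    [P.IsPrime] {e : ℕ} (φ : FrobeniusPushforward (Localization.AtPrime P) p e →ₗ[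
      Localization.AtPrime P] Localization.AtPrime P) :
    ∃ ψ : FrobeniusPushforward R p e →ₗ[R] R, ∃ s ∉ P, ∀ x : R,
      algebraMap R (Localization.AtPrime P) (ψ (of R p e x)) =
        algebraMap R _ s * φ (of _ p e (algebraMap R _ x)) := by
  have := h.finite e
  have : Module.FinitePresentation R (FrobeniusPushforward R p e) :=
    Module.finitePresentation_of_finite R _
  let g : FrobeniusPushforward R p e →ₗ[R] Localization.AtPrime P :=
    { toFun := fun x => φ (of _ p e (algebraMap R _ ((of R p e).symm x)))
      map_add' := fun x y => by simp
      map_smul' := fun r x => by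
        obtain ⟨x, rfl⟩ := (of R p e).surjective x
        rw [smul_of, RingEquiv.symm_apply_apply, RingEquiv.symm_apply_apply, map_mul, map_pow,
          map_of_pow_mul, RingHom.id_apply, Algebra.smul_def] }
  obtain ⟨ψ, s, hψ⟩ := Module.FinitePresentation.exists_lift_of_isLocalizedModule P.primeCompl
    (Algebra.linearMap R (Localization.AtPrime P)) g
  refine ⟨ψ, s, s.2, fun x => ?_⟩
  have := LinearMap.congr_fun hψ (of R p e x)
  rw [← Algebra.smul_def]
  exact this

/-- A local ring is strongly F-regular as soon as its localization at the splitting prime is. -/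
theorem isStronglyFRegular_of_localization_splittingPrime [IsNoetherianRing R] [IsLocalRing R]
    (hfin : IsFFinite p R) [hP : (splittingPrime p R).IsPrime]
    (h : IsStronglyFRegular p (Localization.AtPrime (splittingPrime p R))) :
    IsStronglyFRegular p R := by
  have hbot : splittingPrime p R = ⊥ := by
    refine (Submodule.eq_bot_iff _).mpr fun c hc => ?_
    -- a nonzero image of `c` in the localization could be sent to `1`, contradicting stability
    have hc0 : algebraMap R (Localization.AtPrime (splittingPrime p R)) c = 0 := by
      by_contra hne
      obtain ⟨e, -, φ, hφ⟩ := h.2.2 _ hne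
      obtain ⟨ψ, s, hs, hψ⟩ := exists_linearMap_of_localization hfin _ φ
      have h1 := hψ c
      rw [hφ, mul_one] at h1
      have h2 := (IsLocalization.AtPrime.to_map_mem_maximal_iff
        (Localization.AtPrime (splittingPrime p R)) (splittingPrime p R) _).mpr
        (map_of_mem_splittingPrime hc ψ)
      rw [h1] at h2
      exact hs ((IsLocalization.AtPrime.to_map_mem_maximal_iff _ _ _).mp h2)
    obtain ⟨s, hs⟩ := (IsLocalization.map_eq_zero_iff (splittingPrime p R).primeCompl _ c).mp hc0
    obtain ⟨e, -, φ, hφ⟩ := notMem_splittingPrime_iff.mp s.2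
    -- `c` times the image of `s` is the image of `c ^ p ^ e * s = 0`
    have h1 := map_of_pow_mul φ c s
    obtain ⟨k, hk⟩ := Nat.exists_eq_succ_of_ne_zero (pow_ne_zero e hp.out.ne_zero)
    rw [hφ, mul_one, hk, pow_succ, mul_assoc, mul_comm c, hs, mul_zero, map_zero, map_zero] at h1
    exact h1.symm
  refine ⟨hfin, ?_, fun c hc => ?_⟩
  · rw [hbot] at hP
    exact (IsDomain.of_bot_isPrime R)
  · refine notMem_splittingPrime_iff.mp ?_
    rwa [hbot]

end Localization

/-! ### Localizations of dimension at most one -/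

section Principal

open FrobeniusPushforward

variable {p : ℕ} [hp : Fact p.Prime] {R : Type u} [CommRing R] [CharP R p]

/-- F-finite fields and discrete valuation rings are strongly F-regular: `F^e_* R` is free, and
`F^e_* c` is part of a basis once `c` does not lie in `𝔪 ^ (p ^ e)`. -/
theorem isStronglyFRegular_of_isPrincipalIdealRing [IsDomain R] [IsPrincipalIdealRing R]
    [IsLocalRing R] (hfin : IsFFinite p R) : IsStronglyFRegular p R := by
  refine ⟨hfin, inferInstance, fun c hc => ?_⟩
  obtain ⟨n, hn⟩ : ∃ n, c ∉ IsLocalRing.maximalIdeal R ^ n := by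
    by_contra! hall
    have := Ideal.iInf_pow_eq_bot_of_isLocalRing (IsLocalRing.maximalIdeal R)
      (IsLocalRing.maximalIdeal.isMaximal R).ne_top
    exact hc ((Submodule.mem_bot R).mp (this ▸ (Submodule.mem_iInf _).mpr hall))
  have hn1 : n + 1 ≤ p ^ (n + 1) := (Nat.lt_pow_self hp.out.one_lt).le
  have hcq : c ∉ IsLocalRing.maximalIdeal R ^ p ^ (n + 1) := fun hmem =>
    hn (Ideal.pow_le_pow_right (by omega) hmem)
  refine ⟨n + 1, n.succ_pos, ?_⟩
  have := hfin.finite (n + 1)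
  have : Module.IsTorsionFree R (FrobeniusPushforward R p (n + 1)) := by
    refine Module.IsTorsionFree.of_smul_eq_zero fun r x hrx => ?_
    obtain ⟨x, rfl⟩ := (of R p (n + 1)).surjective x
    rw [smul_of, map_eq_zero_iff _ (of R p (n + 1)).injective, mul_eq_zero] at hrx
    exact hrx.imp eq_zero_of_pow_eq_zero fun hx => by rw [hx, map_zero]
  let b := Module.Free.chooseBasis R (FrobeniusPushforward R p (n + 1))
  obtain ⟨i, hi⟩ : ∃ i, IsUnit (b.coord i (of R p (n + 1) c)) := by
    by_contra! hall
    refine hcq ?_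
    have hsum := b.sum_repr (of R p (n + 1) c)
    have hc' : c = ∑ i, (b.repr (of R p (n + 1) c) i) ^ p ^ (n + 1) *
        (of R p (n + 1)).symm (b i) := by
      apply (of R p (n + 1)).injective
      rw [map_sum]
      conv_lhs => rw [← hsum]
      refine Finset.sum_congr rfl fun i _ => ?_
      rw [← smul_of, RingEquiv.apply_symm_apply]
    rw [hc']
    exact sum_mem fun i _ => Ideal.mul_mem_right _ _ (Ideal.pow_mem_pow (hall i) _)
  obtain ⟨u, hu⟩ := hi
  refine ⟨(↑u⁻¹ : R) • b.coord i, ?_⟩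
  rw [LinearMap.smul_apply, ← hu, smul_eq_mul, Units.inv_mul]

theorem isPrincipalIdealRing_localization_of_ringKrullDim_le_one [IsDomain R]
    [IsIntegrallyClosed R] [IsNoetherianRing R] (P : Ideal R) [P.IsPrime]
    (h : ringKrullDim (Localization.AtPrime P) ≤ (1 : ℕ)) :
    IsPrincipalIdealRing (Localization.AtPrime P) := by
  have : IsDomain (Localization.AtPrime P) := IsLocalization.isDomain_of_atPrime _ P
  have : IsIntegrallyClosed (Localization.AtPrime P) :=
    isIntegrallyClosed_of_isLocalization _ P.primeCompl P.primeCompl_le_nonZeroDivisors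
  have : IsNoetherianRing (Localization.AtPrime P) :=
    IsLocalization.isNoetherianRing P.primeCompl _ inferInstance
  have : Ring.KrullDimLE 1 (Localization.AtPrime P) := Ring.krullDimLE_iff.mpr h
  have : Ring.DimensionLEOne (Localization.AtPrime P) :=
    ⟨fun {I} hI hI' => (Ring.krullDimLE_one_iff_of_isPrime_bot.mp this I hI hI')⟩
  have : IsDedekindDomain (Localization.AtPrime P) := { }
  infer_instance

end Principal

/-! ### Strong F-regularity from the defect of the F-pure threshold -/

theorem mainTheorem12 (p : ℕ) [Fact p.Prime] (R : Type u) [CommRing R] [IsNoetherianRing R]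
    [IsLocalRing R] [CharP R p] (hfin : IsFFinite p R) (hpure : IsFPure p R) :
    (∀ k : ℕ, 0 < k → dfpt p R < (k : EReal) + 1 →
      (∀ (P : Ideal R) [P.IsPrime],
        ringKrullDim (Localization.AtPrime P) ≤ k →
          IsStronglyFRegular p (Localization.AtPrime P)) →
      IsStronglyFRegular p R) ∧
    (dfpt p R < 2 → IsDomain R → IsIntegrallyClosed R → IsStronglyFRegular p R) := by
  have main : ∀ k : ℕ, 0 < k → dfpt p R < (k : EReal) + 1 →
      (∀ (P : Ideal R) [P.IsPrime],
        ringKrullDim (Localization.AtPrime P) ≤ k →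
          IsStronglyFRegular p (Localization.AtPrime P)) →
      IsStronglyFRegular p R := by
    intro k _ hk hreg
    obtain ⟨h1, hht⟩ := splittingPrime_height_le_of_dfpt_lt hk
    have := splittingPrime_isPrime h1
    refine isStronglyFRegular_of_localization_splittingPrime hfin (hreg _ ?_)
    rw [IsLocalization.AtPrime.ringKrullDim_eq_height (splittingPrime p R)]
    exact_mod_cast hht
  refine ⟨main, fun h hdom hic => main 1 one_pos (h.trans_eq ?_) fun P _ hP => ?_⟩
  · norm_num
  · have := isPrincipalIdealRing_localization_of_ringKrullDim_le_one P hP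
    have : IsDomain (Localization.AtPrime P) := IsLocalization.isDomain_of_atPrime _ P
    exact isStronglyFRegular_of_isPrincipalIdealRing (hfin.localization_atPrime P)
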